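/- Let $X$ be a nonzero real Banach space with dual $X^*$. For a multivalued operator $T:X\rightrightarrows X^*$ write $G(T)=\{(x,x^*): x^*\in T(x)\}$ and $D_T=\{x: T(x)\neq\emptyset\}$. $T$ is monotone if $\langle x^*-y^*,x-y\rangle\ge 0$ for all $(x,x^*),(y,y^*)\in G(T)$, and maximal monotone if moreover no monotone operator has a graph strictly containing $G(T)$. A maximal monotone operator $T$ is of type (FPV) if for every open convex $U\subset X$ with $U\cap D_T\ne\emptyset$ and every $(x,x^*)\in U\times X^*$ such that $\langle x^*-y^*,x-y\rangle\ge0$ for all $(y,y^*)\in G(T)$ with $y\in U$, one has $(x,x^*)\in G(T)$. A maximal monotone operator $T$ is regular if $L(x,x^*,T)=d(x^*,T(x))$ for all $(x,x^*)\in X\times X^*$, where $d(x^*,\emptyset)=\infty$ and $$L(x,x^*,T)=\max\Bigl\{0,\ \sup\Bigl\{\frac{\langle y^*-x^*,x-y\rangle}{\|x-y\|}: (y,y^*)\in G(T),\ y\neq x\Bigr\}\Bigr\}\in[0,\infty]$$ (with $\sup\emptyset=-\infty$). For $C\subset X$ let $I_C$ be the function equal to $0$ on $C$ and to $+\infty$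 off $C$, and $\partial I_C$ its subdifferential, so that $\partial I_C(x)=\{x^*:\langle x^*,y-x\rangle\le0\ \forall y\in C\}$ for $x\in C$ and $\partial I_C(x)=\emptyset$ for $x\notin C$; sums of operators are pointwise Minkowski sums. Let $$\mathcal C_0(T)=\{C\subset X: C \text{ closed, convex, } D_T\cap\operatorname{int}C\ne\emptyset\},$$ $$\mathcal C_1(T)=\Bigl\{C\subset X: C\text{ closed, convex, and }\bigcup_{\lambda>0}\lambda(\operatorname{co}D_T-C)\text{ is a closed linear subspace of }X\Bigr\}.$$ $T$ is called $\mathcal C_i$-regular ($i\in\{0,1\}$) if $T+\partial I_C$ is a regular maximal monotone operator for every $C\in\mathcal C_i(T)$. Proposition 2.8. Let $T:X\rightrightarrows X^*$ be a maximal monotone operator. (1) If $D_T$ is closed and convex and $C\in\mathcal C_1(T)$, then $T+\partial I_C$ is a regular maximal monotone operator. Consequently, $T$ is $\mathcal C_1$-regular. (2) If $T$ is of type (FPV), $D_T$ is convex and $C\in\mathcal C_0(T)$, then $T+\partial I_C$ is a regular maximal monotone operator. Consequently, $T$ is $\mathcal C_0$-regular. -/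

import Mathlib

open scoped Pointwise

namespace MonotoneOperator

section

variable {X : Type*} [NormedAddCommGroup X] [NormedSpace ℝ X]

/-- The graph of a multivalued operator `T : X ⇉ X*`. -/
def graph (T : X → Set (StrongDual ℝ X)) : Set (X × StrongDual ℝ X) :=
  {p | p.2 ∈ T p.1}

/-- The domain `D_T`. -/
def dom (T : X → Set (StrongDual ℝ X)) : Set X :=
  {x | (T x).Nonempty}

/-- Monotonicity: `⟨x* - y*, x - y⟩ ≥ 0` on the graph. -/
def IsMonotone (T : X → Set (StrongDual ℝ X)) : Prop :=
  ∀ p ∈ graph T, ∀ q ∈ graph T, 0 ≤ (p.2 - q.2) (p.1 - q.1)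

/-- Maximal monotonicity: monotone, and no monotone operator has a strictly larger graph. -/
def IsMaximalMonotone (T : X → Set (StrongDual ℝ X)) : Prop :=
  IsMonotone T ∧ ¬ ∃ S : X → Set (StrongDual ℝ X), IsMonotone S ∧ graph T ⊂ graph S

/-- Maximal monotone operators of type (FPV) (also called maximal monotone locally): if `U` is open
and convex, `U` meets the domain, and `(x, x*) ∈ U × X*` is monotonically related to the part of
the graph over `U`, then `(x, x*)` lies in the graph. -/
def IsFPV (T : X → Set (StrongDual ℝ X)) : Prop :=
  IsMaximalMonotone T ∧
    ∀ U : Set X, IsOpen U → Convex ℝ U → (U ∩ dom T).Nonempty →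
      ∀ x ∈ U, ∀ x' : StrongDual ℝ X,
        (∀ p ∈ graph T, p.1 ∈ U → 0 ≤ (x' - p.2) (x - p.1)) → (x, x') ∈ graph T

/-- The number `L(x, x*, T) ∈ [0, ∞]`: the supremum of `⟨y* - x*, x - y⟩ / ‖x - y‖` over the graph
points `(y, y*)` with `y ≠ x`, taken in `[0, ∞]`. Thus it is the maximum of `0` and the supremum in
the extended reals; it is `0` if there is no such point or if all quotients are negative. -/
noncomputable def L (x : X) (x' : StrongDual ℝ X) (T : X → Set (StrongDual ℝ X)) : ENNReal :=
  ⨆ p ∈ {p ∈ graph T | p.1 ≠ x}, ENNReal.ofReal ((p.2 - x') (x - p.1) / ‖x - p.1‖)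

/-- Regular maximal monotone operators: maximal monotone with `L(x, x*, T) = d(x*, T(x))` for all
`(x, x*)`, where the distance to the empty set is `∞`. -/
def IsRegularMaximalMonotone (T : X → Set (StrongDual ℝ X)) : Prop :=
  IsMaximalMonotone T ∧
    ∀ (x : X) (x' : StrongDual ℝ X), L x x' T = Metric.infEDist x' (T x)

open Classical in
/-- The indicator function `I_C` of convex analysis: `0` on `C` and `∞` outside. -/
noncomputable def indicatorFun (C : Set X) : X → EReal :=
  fun x => if x ∈ C then 0 else ⊤

/-- The subdifferential of an extended-real-valued function; it is empty at the points where the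
function is not finite. -/
def subdifferential (f : X → EReal) : X → Set (StrongDual ℝ X) :=
  fun x => {x' | f x ≠ ⊤ ∧ f x ≠ ⊥ ∧ ∀ y : X, f x + ((x' (y - x) : ℝ) : EReal) ≤ f y}

/-- The class `𝒞₀(T)`: closed convex sets whose interior meets the domain. -/
def classC0 (T : X → Set (StrongDual ℝ X)) : Set (Set X) :=
  {C | IsClosed C ∧ Convex ℝ C ∧ (dom T ∩ interior C).Nonempty}

/-- The class `𝒞₁(T)`: closed convex sets `C` for which `⋃_{r > 0} r (co D_T - C)` is a closed
linear subspace. -/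
def classC1 (T : X → Set (StrongDual ℝ X)) : Set (Set X) :=
  {C | IsClosed C ∧ Convex ℝ C ∧
    ∃ V : Submodule ℝ X, IsClosed (V : Set X) ∧
      (⋃ r ∈ Set.Ioi (0 : ℝ), r • (convexHull ℝ (dom T) - C)) = (V : Set X)}

/-- `T` is `𝒞₀`-regular. The sum of operators is the pointwise Minkowski sum. -/
def IsC0Regular (T : X → Set (StrongDual ℝ X)) : Prop :=
  ∀ C ∈ classC0 T, IsRegularMaximalMonotone (T + subdifferential (indicatorFun C))

/-- `T` is `𝒞₁`-regular. -/
def IsC1Regular (T : X → Set (StrongDual ℝ X)) : Prop :=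
  ∀ C ∈ classC1 T, IsRegularMaximalMonotone (T + subdifferential (indicatorFun C))

end

end MonotoneOperator

/-!
Let `D = dom T` and let `N_C` be the normal cone of `C`, that is, the subdifferential of the
indicator function of `C`.

Maximality and regularity of `T + N_C` are one statement
(`IsMonotone.isRegularMaximalMonotone`): whenever `⟨y* - x*, y - x⟩ + M ‖y - x‖ ≥ 0` on the graph
of `T + N_C`, the point `x*` is within distance `M` of `(T + N_C) x`. Taking `M = 0` gives
maximality, and `M = L(x, x*, T + N_C)` gives regularity. After a translation, `(x, x*) = (0, 0)`.

Suppose that `0 ∈ C` and that the Fitzpatrick function `φ` of `T` satisfies `φ(y, y*) ≥ -M ‖y‖` for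
`y ∈ D ∩ C`. Then minimizing `φ(z, z*) + M ‖y‖` over `z ∈ D`, `y ∈ C` subject to `z = y` has value
at least `0`, and a Lagrange multiplier `u` for the constraint satisfies `⟨u, z⟩ ≤ ⟨z*, z⟩` on the
graph of `T`, so that `u ∈ T 0` by maximality, and `⟨u, y⟩ + M ‖y‖ ≥ 0` on `C`, so that `u + n` has
norm at most `M` for some `n ∈ N_C 0` (`IsMaximalMonotone.exists_norm_add_le`). The multiplier
exists if the value function of the problem is bounded above near `0` in the space spanned by
`D - C` (`exists_dual_comp_le`). For `C ∈ 𝒞₁(T)` and `D` closed this is a consequence of Baire's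
theorem (`exists_ball_subset_image`); for `C ∈ 𝒞₀(T)` it is immediate.

It remains to locate the origin and to bound `φ`. If `D` is closed, then `0 ∈ D ∩ C`: otherwise
Ekeland's principle provides a normal of `D ∩ C` that is negative at its support point, and this
normal splits into a normal of `D`, which `T` absorbs, and a normal of `C`; its multiples contradict
the hypothesis. The bound for `φ` follows by testing with graph points over `t y`, `t → 0`. If `T`
is of type (FPV), then `0 ∈ closure (D ∩ C)` (`IsFPV.zero_mem_closure`). The points `t y` may then
lie outside `D`, but type (FPV) supplies graph points near them that serve the same purpose
(`IsFPV.neg_mul_norm_le_of_mem_interior`).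
-/

namespace MonotoneOperator

/-! ### Convex analysis -/

section ConvexAnalysis

/-- Ekeland's variational principle for the norm on a nonempty closed set, with slope `1 / 2`. -/
theorem exists_norm_le_norm_add_half_norm_sub {X : Type*} [NormedAddCommGroup X]
    [CompleteSpace X] {A : Set X} (hA : IsClosed A)
    (hne : A.Nonempty) : ∃ y ∈ A, ∀ z ∈ A, ‖y‖ ≤ ‖z‖ + 1 / 2 * ‖z - y‖ := by
  let S : X → Set X := fun y => {z ∈ A | ‖z‖ + 1 / 2 * ‖z - y‖ ≤ ‖y‖}
  have hself : ∀ y ∈ A, y ∈ S y := fun y hy => ⟨hy, by simp⟩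
  have htrans : ∀ x y z, y ∈ S x → z ∈ S y → z ∈ S x := fun x y z hy hz => ⟨hz.1, by
    have h1 := hy.2
    have h2 := hz.2
    have h3 := norm_sub_le_norm_sub_add_norm_sub z y x
    linarith⟩
  have hstep : ∀ (n : ℕ) (y : A), ∃ z : A, (z : X) ∈ S y ∧
      ∀ w ∈ S y, ‖(z : X)‖ ≤ ‖w‖ + (1 / 2 : ℝ) ^ n := by
    intro n y
    have hbdd : BddBelow (norm '' S y) := ⟨0, by rintro _ ⟨w, -, rfl⟩; exact norm_nonneg w⟩
    obtain ⟨_, ⟨z, hz, rfl⟩, hlt⟩ := exists_lt_of_csInf_lt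
      (Set.Nonempty.image norm ⟨_, hself y y.2⟩)
      (lt_add_of_pos_right (sInf (norm '' S y)) (by positivity : (0 : ℝ) < (1 / 2) ^ n))
    refine ⟨⟨z, hz.1⟩, hz, fun w hw => ?_⟩
    have := csInf_le hbdd ⟨w, hw, rfl⟩
    simp only
    linarith
  choose g hgS hg using hstep
  obtain ⟨y0, hy0⟩ := hne
  let u : ℕ → A := fun n => Nat.rec ⟨y0, hy0⟩ (fun k y => g k y) n
  have hu : ∀ n, u (n + 1) = g n (u n) := fun n => rfl
  have hmono : ∀ n k : ℕ, (u (n + k)).1 ∈ S (u n).1 := by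
    intro n k
    induction k with
    | zero => exact hself (u n).1 (u n).2
    | succ k ih => exact htrans _ _ _ ih (by rw [← add_assoc, hu]; exact hgS _ _)
  have hanti : Antitone fun n => ‖(u n).1‖ := antitone_nat_of_succ_le fun n => by
    have := (hmono n 1).2
    have h2 := norm_nonneg ((u (n + 1)).1 - u n)
    linarith
  have hbelow : BddBelow (Set.range fun n => ‖(u n).1‖) :=
    ⟨0, by rintro _ ⟨n, rfl⟩; exact norm_nonneg _⟩
  have hconv := tendsto_atTop_ciInf hanti hbelow
  have hcauchy : CauchySeq fun n => (u n).1 := by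
    refine cauchySeq_of_le_tendsto_0
      (fun n => 2 * (‖(u n).1‖ - ⨅ n, ‖(u n).1‖) + 2 * (‖(u n).1‖ - ⨅ n, ‖(u n).1‖)) ?_ ?_
    · have hd : ∀ n m : ℕ, n ≤ m → dist (u m).1 (u n).1 ≤ 2 * (‖(u n).1‖ - ⨅ n, ‖(u n).1‖) := by
        intro n m hnm
        obtain ⟨k, rfl⟩ := Nat.exists_eq_add_of_le hnm
        have h1 := (hmono n k).2
        have h2 := ciInf_le hbelow (n + k)
        rw [dist_eq_norm]
        linarith
      intro n m N hn hm
      exact (dist_triangle_right _ _ (u N).1).trans (add_le_add (hd N n hn) (hd N m hm))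
    · have := (hconv.sub_const (⨅ n, ‖(u n).1‖)).const_mul 2
      simpa using this.add this
  obtain ⟨y, hy⟩ := cauchySeq_tendsto_of_complete hcauchy
  have hyA : y ∈ A := hA.mem_of_tendsto hy (Filter.Eventually.of_forall fun n => (u n).2)
  have hyS : ∀ n, y ∈ S (u n).1 := by
    intro n
    refine ⟨hyA, ?_⟩
    have hcont : Filter.Tendsto (fun k => ‖(u (k + n)).1‖ + 1 / 2 * ‖(u (k + n)).1 - (u n).1‖)
        Filter.atTop (nhds (‖y‖ + 1 / 2 * ‖y - (u n).1‖)) := by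
      have := (Filter.tendsto_add_atTop_iff_nat n).2 hy
      exact this.norm.add ((this.sub_const _).norm.const_mul _)
    exact le_of_tendsto hcont (Filter.Eventually.of_forall fun k => by
      rw [add_comm k n]; exact (hmono n k).2)
  refine ⟨y, hyA, fun z hz => ?_⟩
  by_contra! hlt
  have hzS : ∀ n, z ∈ S (u n).1 := fun n => htrans _ _ _ (hyS n) ⟨hz, hlt.le⟩
  have h1 : ‖y‖ ≤ ‖z‖ := by
    have hl := (Filter.tendsto_add_atTop_iff_nat 1).2 hy.norm
    have hr := (tendsto_pow_atTop_nhds_zero_of_lt_one (by norm_num : (0 : ℝ) ≤ 1 / 2)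
      (by norm_num)).const_add ‖z‖
    rw [add_zero] at hr
    exact le_of_tendsto_of_tendsto' hl hr fun n => by rw [hu]; exact hg n _ z (hzS n)
  have h2 := norm_nonneg (z - y)
  linarith

variable {X : Type*} [NormedAddCommGroup X] [NormedSpace ℝ X]

/-- A Lagrange multiplier theorem. If `F` is convex on `Γ`, nonnegative on the part of `Γ` that the
linear map `ℓ` sends to `0`, and if every small vector of the subspace `V ⊇ ℓ(Γ)` has a preimage in
`Γ` at which `F` is at most `K`, then `F` dominates `p ∘ ℓ` on `Γ` for some `p ∈ X*`. In other
words, the value function `v ↦ inf {F e | e ∈ Γ, ℓ e = v}` has a subgradient at `0`. -/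
theorem exists_dual_comp_le {E : Type*} [AddCommGroup E] [Module ℝ E] {Γ : Set E} {F : E → ℝ}
    (hF : ConvexOn ℝ Γ F) (ℓ : E →ₗ[ℝ] X) (V : Submodule ℝ X) (hV : ∀ e ∈ Γ, ℓ e ∈ V)
    (h0 : ∀ e ∈ Γ, ℓ e = 0 → 0 ≤ F e) {ρ K : ℝ} (hρ : 0 < ρ)
    (hb : ∀ v ∈ V, ‖v‖ < ρ → ∃ e ∈ Γ, ℓ e = v ∧ F e ≤ K) :
    ∃ p : StrongDual ℝ X, ∀ e ∈ Γ, p (ℓ e) ≤ F e := by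
  -- The strict epigraph of the value function, as a subset of `V × ℝ`.
  set P : Set (V × ℝ) := {q | ∃ e ∈ Γ, ℓ e = q.1 ∧ F e < q.2} with hP
  have hPconv : Convex ℝ P := by
    rintro ⟨v, s⟩ ⟨e, he, hv, hs⟩ ⟨v', s'⟩ ⟨e', he', hv', hs'⟩ a b ha hb hab
    simp only at hv hs hv' hs'
    refine ⟨a • e + b • e', hF.1 he he' ha hb hab, by simp [hv, hv'], ?_⟩
    refine (hF.2 he he' ha hb hab).trans_lt ?_
    simp only [Prod.smul_mk, Prod.mk_add_mk, smul_eq_mul]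
    rcases ha.eq_or_lt with rfl | ha
    · have : b = 1 := by linarith
      subst this
      linarith
    · nlinarith [mul_lt_mul_of_pos_left hs ha, mul_le_mul_of_nonneg_left hs'.le hb]
  have hsub : Metric.ball (0 : V) ρ ×ˢ Set.Ioi K ⊆ P := by
    rintro ⟨v, s⟩ ⟨hv, hs : K < s⟩
    obtain ⟨e, he, hev, hK⟩ := hb v v.2 (by simpa using hv)
    exact ⟨e, he, hev, hK.trans_lt hs⟩
  have hint : (interior P).Nonempty :=
    ⟨(0, K + 1), interior_maximal hsub (Metric.isOpen_ball.prod isOpen_Ioi) ⟨by simpa using hρ,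
      by simp⟩⟩
  have h0P : (0 : V × ℝ) ∉ interior P := fun h => by
    obtain ⟨e, he, h1, h2⟩ := interior_subset h
    exact absurd (h0 e he (by simpa using h1)) (by simpa using h2)
  obtain ⟨f, hf0, hf⟩ := geometric_hahn_banach_of_nonempty_interior_point hPconv h0P hint
  have hdec : ∀ v s, f (v, s) = f (v, 0) + s * f (0, 1) := fun v s => by
    rw [← smul_eq_mul, ← map_smul, ← map_add]
    simp
  have hle : ∀ v : V, ‖v‖ < ρ → ∀ s, K < s → f (v, 0) + s * f (0, 1) ≤ 0 := fun v hv s hs => by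
    rw [← hdec]
    have hmem : (v, s) ∈ Metric.ball (0 : V) ρ ×ˢ Set.Ioi K := ⟨by simpa using hv, hs⟩
    simpa using hf _ (hsub hmem)
  have hβ : f (0, 1) < 0 := by
    have h1 := hle 0 (by simpa using hρ) (max K 0 + 1) (by linarith [le_max_left K 0])
    have h2 : f ((0 : V), (0 : ℝ)) = 0 := map_zero f
    rw [h2] at h1
    rcases lt_trichotomy (f (0, 1)) 0 with h | h | h
    · exact h
    · -- A functional with no vertical component would be nonpositive on a ball of `V`.
      exfalso
      apply hf0
      have hball : ∀ v : V, ‖v‖ < ρ → f (v, 0) ≤ 0 := fun v hv => by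
        simpa [h] using hle v hv (K + 1) (by linarith)
      have hz : ∀ v : V, f (v, 0) = 0 := fun v => by
        have hc : 0 < ρ / (‖v‖ + 1) := by positivity
        have hn : ‖(ρ / (‖v‖ + 1)) • v‖ < ρ := by
          rw [norm_smul, Real.norm_of_nonneg hc.le, div_mul_eq_mul_div, div_lt_iff₀ (by positivity)]
          nlinarith [norm_nonneg v]
        have e1 : ((ρ / (‖v‖ + 1)) • v, (0 : ℝ)) = (ρ / (‖v‖ + 1)) • (v, (0 : ℝ)) := by simp
        have e2 : (-((ρ / (‖v‖ + 1)) • v), (0 : ℝ)) = -((ρ / (‖v‖ + 1)) • (v, (0 : ℝ))) := by simp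
        have a1 := hball _ hn
        have a2 := hball (-((ρ / (‖v‖ + 1)) • v)) (by rwa [norm_neg])
        rw [e1, map_smul, smul_eq_mul] at a1
        rw [e2, map_neg, map_smul, smul_eq_mul] at a2
        have a3 : (ρ / (‖v‖ + 1)) * f (v, 0) = 0 := by linarith
        exact (mul_eq_zero.1 a3).resolve_left hc.ne'
      refine ContinuousLinearMap.ext fun ⟨v, s⟩ => ?_
      rw [hdec, h, hz]
      simp
    · nlinarith [le_max_right K 0]
  obtain ⟨g, hg, -⟩ := _root_.exists_extension_norm_eq V (f.comp (ContinuousLinearMap.inl ℝ V ℝ))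
  refine ⟨(-(f (0, 1)))⁻¹ • g, fun e he => ?_⟩
  have hge : g (ℓ e) = f (⟨ℓ e, hV e he⟩, 0) := hg ⟨ℓ e, hV e he⟩
  have key : g (ℓ e) ≤ -(f (0, 1)) * F e := by
    refine le_of_forall_pos_le_add fun ε hε => ?_
    have := hf (⟨ℓ e, hV e he⟩, F e + ε / (-(f (0, 1)))) ⟨e, he, rfl, by
      simp only
      have : 0 < ε / (-(f (0, 1))) := div_pos hε (by linarith)
      linarith⟩
    rw [hdec, ← hge, map_zero, add_mul, div_mul_eq_mul_div, div_neg, mul_div_assoc,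
      div_self hβ.ne] at this
    linarith
  rw [smul_apply, smul_eq_mul, inv_mul_le_iff₀ (by linarith)]
  exact key

/-- An open mapping theorem for closed convex sets. If `Γ` is a closed convex subset of a Banach
space and the cone generated by `ℓ(Γ)` is a closed subspace `V` of a Banach space, then a bounded
part of `Γ` is mapped by `ℓ` onto a neighbourhood of `0` in `V`. -/
theorem exists_ball_subset_image [CompleteSpace X] {E : Type*} [NormedAddCommGroup E]
    [NormedSpace ℝ E] [CompleteSpace E] {Γ : Set E} (hc : IsClosed Γ) (hconv : Convex ℝ Γ)
    (ℓ : E →L[ℝ] X) (V : Submodule ℝ X) (hVc : IsClosed (V : Set X)) (hV : ∀ e ∈ Γ, ℓ e ∈ V)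
    (habs : ∀ v ∈ V, ∃ r > (0 : ℝ), ∃ e ∈ Γ, v = r • ℓ e) :
    ∃ ρ > 0, ∃ N, ∀ v ∈ V, ‖v‖ < ρ → ∃ e ∈ Γ, ‖e‖ ≤ N ∧ ℓ e = v := by
  have hVcomp : CompleteSpace V := hVc.completeSpace_coe
  obtain ⟨-, -, e0, he0, h00⟩ : ∃ r > (0 : ℝ), ∃ e ∈ Γ, ℓ e = 0 := by
    obtain ⟨r, hr, e, he, h⟩ := habs 0 V.zero_mem
    exact ⟨r, hr, e, he, (smul_eq_zero.1 h.symm).resolve_left hr.ne'⟩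
  -- By Baire, the image of a bounded part of `Γ` is dense in some ball of `V`.
  let A : ℕ → Set V := fun n => {v | ∃ e ∈ Γ, ‖e‖ ≤ n ∧ (v : X) = ((n : ℝ) + 1) • ℓ e}
  have hA : (⋃ n, closure (A n)) = Set.univ := by
    refine Set.eq_univ_of_forall fun v => Set.mem_iUnion.2 ?_
    obtain ⟨r, hr, e, he, h⟩ := habs v v.2
    obtain ⟨n, hn⟩ := exists_nat_ge (max r (max ‖e‖ ‖e0‖))
    simp only [max_le_iff] at hn
    refine ⟨n, subset_closure ?_⟩
    have hn1 : (0 : ℝ) < n + 1 := by positivity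
    have hconvex : (r / (n + 1)) • e + (1 - r / (n + 1)) • e0 ∈ Γ ∩ Metric.closedBall 0 n := by
      refine (hconv.inter (convex_closedBall 0 (n : ℝ))) ⟨he, by simpa using hn.2.1⟩
        ⟨he0, by simpa using hn.2.2⟩ (by positivity) ?_ (by ring)
      rw [sub_nonneg, div_le_one hn1]
      linarith
    refine ⟨_, hconvex.1, by simpa using hconvex.2, ?_⟩
    rw [map_add, map_smul, map_smul, h00, smul_zero, add_zero, smul_smul, mul_div_cancel₀ _ hn1.ne',
      h]
  obtain ⟨n, v0, hv0⟩ := nonempty_interior_of_iUnion_of_closed (fun _ => isClosed_closure) hA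
  obtain ⟨δ, hδ, hball⟩ := Metric.isOpen_iff.1 isOpen_interior v0 hv0
  obtain ⟨r, hr, e1, he1, h1⟩ := habs (-v0) (V.neg_mem v0.2)
  set N : ℝ := max n ‖e1‖ with hN
  set Γ' := Γ ∩ Metric.closedBall 0 N with hΓ'
  have hconv' : Convex ℝ Γ' := hconv.inter (convex_closedBall 0 N)
  have hc' : IsClosed Γ' := hc.inter Metric.isClosed_closedBall
  -- Mixing in `e1`, which is mapped opposite to `v0`, moves this ball to the origin.
  set M : ℝ := n + 1 + r with hM
  have hMpos : 0 < M := by positivity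
  have hdense : ∀ w ∈ V, ‖w‖ < δ / M → ∀ η > 0, ∃ e ∈ Γ', ‖w - ℓ e‖ < η := by
    intro w hw hwn η hη
    have hmem : v0 + M • (⟨w, hw⟩ : V) ∈ closure (A n) := by
      refine interior_subset (hball ?_)
      rw [Metric.mem_ball, dist_self_add_left, norm_smul, Real.norm_of_nonneg hMpos.le]
      rw [lt_div_iff₀ hMpos, mul_comm] at hwn
      exact hwn
    obtain ⟨v', ⟨e', he', hne', hve'⟩, hd⟩ := Metric.mem_closure_iff.1 hmem (M * η) (by positivity)
    refine ⟨((n + 1) / M) • e' + (r / M) • e1, ?_, ?_⟩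
    · refine hconv' ⟨he', by simpa [hN] using Or.inl hne'⟩ ⟨he1, by simp [hN]⟩ (by positivity)
        (by positivity) ?_
      rw [← add_div, div_self hMpos.ne']
    · have hrw : w - ℓ (((n + 1) / M) • e' + (r / M) • e1)
          = M⁻¹ • (((v0 + M • (⟨w, hw⟩ : V) : V) : X) - v') := by
        rw [map_add, map_smul, map_smul, div_eq_inv_mul, div_eq_inv_mul, mul_smul, mul_smul, ← hve',
          ← h1]
        simp only [Submodule.coe_add, Submodule.coe_smul, smul_sub, smul_add, smul_neg, smul_smul,
          inv_mul_cancel₀ hMpos.ne', one_smul]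
        abel
      rw [hrw, norm_smul, Real.norm_of_nonneg (by positivity), inv_mul_lt_iff₀ hMpos]
      rw [dist_eq_norm] at hd
      exact hd
  set ρ := δ / M with hρ
  have hρpos : 0 < ρ := by positivity
  -- Successive approximation, the errors being doubled at each step.
  have hstep : ∀ v : {v : X // v ∈ V ∧ ‖v‖ < ρ / 2}, ∃ e ∈ Γ', ‖(2 : ℝ) • v.1 - ℓ e‖ < ρ / 2 := by
    intro v
    refine hdense _ (V.smul_mem 2 v.2.1) ?_ _ (by positivity)
    rw [norm_smul, Real.norm_of_nonneg zero_le_two]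
    linarith [v.2.2]
  choose g hgΓ hg using hstep
  refine ⟨ρ / 2, by positivity, N, fun v hv hvn => ?_⟩
  let next : {v : X // v ∈ V ∧ ‖v‖ < ρ / 2} → {v : X // v ∈ V ∧ ‖v‖ < ρ / 2} := fun v =>
    ⟨(2 : ℝ) • v.1 - ℓ (g v), V.sub_mem (V.smul_mem 2 v.2.1) (hV _ (hgΓ v).1), hg v⟩
  let u : ℕ → {v : X // v ∈ V ∧ ‖v‖ < ρ / 2} := fun k => next^[k] ⟨v, hv, hvn⟩
  have hu : ∀ k, (u (k + 1)).1 = (2 : ℝ) • (u k).1 - ℓ (g (u k)) := fun k => by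
    simp only [u, Function.iterate_succ_apply', next]
  let S : ℕ → E := fun k => ∑ j ∈ Finset.range k, ((1 / 2 : ℝ) ^ (j + 1)) • g (u j)
  have hS : ∀ k, ℓ (S k) = v - ((1 / 2 : ℝ) ^ k) • (u k).1 := by
    intro k
    induction k with
    | zero => simp [S, u]
    | succ k ih =>
      simp only [S, Finset.sum_range_succ, map_add, map_smul] at ih ⊢
      rw [ih, hu, smul_sub, smul_smul, pow_succ, mul_assoc, one_div_mul_cancel two_ne_zero, mul_one]
      abel
  have hSΓ : ∀ k, ∀ c ∈ Γ', S k + ((1 / 2 : ℝ) ^ k) • c ∈ Γ' := by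
    intro k
    induction k with
    | zero => intro c hc; simpa [S] using hc
    | succ k ih =>
      intro c hc
      have := ih _ (hconv' (hgΓ (u k)) hc (by norm_num : (0 : ℝ) ≤ 1 / 2)
        (by norm_num : (0 : ℝ) ≤ 1 / 2) (by norm_num))
      convert this using 1
      simp only [S, Finset.sum_range_succ, smul_add, smul_smul, pow_succ]
      abel
  have hsum : Summable fun j => ((1 / 2 : ℝ) ^ (j + 1)) • g (u j) := by
    refine Summable.of_norm_bounded (g := fun j => (1 / 2 : ℝ) ^ (j + 1) * N) ?_ fun j => ?_
    · exact ((summable_nat_add_iff 1).2 summable_geometric_two).mul_right N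
    · rw [norm_smul, Real.norm_of_nonneg (by positivity)]
      have : ‖g (u j)‖ ≤ N := by simpa using (hgΓ (u j)).2
      gcongr
  have hlim := hsum.hasSum.tendsto_sum_nat
  have hpow : Filter.Tendsto (fun k : ℕ => (1 / 2 : ℝ) ^ k) Filter.atTop (nhds 0) :=
    tendsto_pow_atTop_nhds_zero_of_lt_one (by norm_num) (by norm_num)
  have hmem : (∑' j, ((1 / 2 : ℝ) ^ (j + 1)) • g (u j)) ∈ Γ' := by
    have hlim' := hlim.add (hpow.smul_const e1)
    rw [zero_smul, add_zero] at hlim'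
    exact hc'.mem_of_tendsto hlim'
      (Filter.Eventually.of_forall fun k => hSΓ k e1 ⟨he1, by simp [hN]⟩)
  refine ⟨∑' j, ((1 / 2 : ℝ) ^ (j + 1)) • g (u j), hmem.1, by simpa using hmem.2, ?_⟩
  refine tendsto_nhds_unique ((ℓ.continuous.tendsto _).comp hlim) ?_
  have hz : Filter.Tendsto (fun k => ((1 / 2 : ℝ) ^ k) • (u k).1) Filter.atTop (nhds 0) := by
    refine squeeze_zero_norm (a := fun k => (1 / 2 : ℝ) ^ k * (ρ / 2)) (fun k => ?_)
      (by simpa using hpow.mul_const (ρ / 2))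
    rw [norm_smul, Real.norm_of_nonneg (by positivity)]
    have : ‖(u k).1‖ < ρ / 2 := (u k).2.2
    gcongr
  have := hz.const_sub v
  rw [sub_zero] at this
  exact this.congr fun k => (hS k).symm

end ConvexAnalysis

end MonotoneOperator

namespace MonotoneOperator

section NormalCone

variable {X : Type*} [NormedAddCommGroup X] [NormedSpace ℝ X]

/-! ### Normal cones -/

/-- The normal cone of `C` at `x`, empty if `x ∉ C`. -/
def normalCone (C : Set X) (x : X) : Set (StrongDual ℝ X) :=
  {n | x ∈ C ∧ ∀ y ∈ C, n (y - x) ≤ 0}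

theorem subdifferential_indicatorFun (C : Set X) :
    subdifferential (indicatorFun C) = normalCone C := by
  ext x n
  by_cases hx : x ∈ C
  · simp only [subdifferential, indicatorFun, normalCone, hx, Set.mem_ofPred_eq, if_true, true_and,
      zero_add]
    refine ⟨fun h y hy => ?_, fun h => ⟨EReal.zero_ne_top, EReal.zero_ne_bot, fun y => ?_⟩⟩
    · have := h.2.2 y
      rw [if_pos hy] at this
      exact_mod_cast this
    · by_cases hy : y ∈ C
      · rw [if_pos hy]
        exact_mod_cast h y hy
      · simp [hy]
  · simp [subdifferential, indicatorFun, normalCone, hx]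

theorem zero_mem_normalCone {C : Set X} {x : X} (hx : x ∈ C) : 0 ∈ normalCone C x :=
  ⟨hx, fun _ _ => by simp⟩

theorem smul_mem_normalCone {C : Set X} {x : X} {n : StrongDual ℝ X} (hn : n ∈ normalCone C x)
    {k : ℝ} (hk : 0 ≤ k) : k • n ∈ normalCone C x :=
  ⟨hn.1, fun y hy => by
    rw [smul_apply, smul_eq_mul]
    exact mul_nonpos_of_nonneg_of_nonpos hk (hn.2 y hy)⟩

/-- `M * ‖·‖` is continuous, so the subdifferential of its sum with the indicator function of `C`
at `0` is the sum of the ball of radius `M` and the normal cone. -/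
theorem exists_mem_normalCone_norm_add_le {C : Set X} (hC : Convex ℝ C) (h0 : (0 : X) ∈ C) {M : ℝ}
    (hM : 0 ≤ M) {u : StrongDual ℝ X} (hu : ∀ y ∈ C, 0 ≤ u y + M * ‖y‖) :
    ∃ n ∈ normalCone C 0, ‖u + n‖ ≤ M := by
  have hF : ConvexOn ℝ (C ×ˢ Set.univ) fun e : X × X => u e.1 + M * ‖e.2‖ := by
    refine ⟨hC.prod convex_univ, fun e _ e' _ a b ha hb _ => ?_⟩
    have h := norm_add_le (a • e.2) (b • e'.2)
    rw [norm_smul, norm_smul, Real.norm_of_nonneg ha, Real.norm_of_nonneg hb] at h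
    have := mul_le_mul_of_nonneg_left h hM
    simp only [Prod.fst_add, Prod.smul_fst, Prod.snd_add, Prod.smul_snd, map_add, map_smul,
      smul_eq_mul]
    linarith
  obtain ⟨p, hp⟩ := exists_dual_comp_le hF
    (LinearMap.fst ℝ X X - LinearMap.snd ℝ X X) ⊤ (fun _ _ => trivial) (fun e he h => by
      have : e.1 = e.2 := by simpa [sub_eq_zero] using h
      simpa [← this] using hu e.1 he.1) (ρ := 1) (K := M) one_pos (fun v _ hv =>
      ⟨(0, -v), ⟨h0, trivial⟩, by simp, by
        simp only [map_zero, norm_neg, zero_add]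
        nlinarith⟩)
  have hp' : ∀ c ∈ C, ∀ y, p (c - y) ≤ u c + M * ‖y‖ := fun c hc y => by
    simpa using hp (c, y) ⟨hc, trivial⟩
  refine ⟨p - u, ⟨h0, fun c hc => ?_⟩, ?_⟩
  · have := hp' c hc 0
    simp only [sub_zero, norm_zero, mul_zero, add_zero] at this
    simpa using this
  · rw [add_sub_cancel]
    refine p.opNorm_le_bound hM fun y => abs_le.2 ⟨?_, ?_⟩
    · have := hp' 0 h0 y
      simp only [zero_sub, map_neg, map_zero, zero_add] at this
      linarith
    · simpa using hp' 0 h0 (-y)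

/-- A closed convex set that misses the origin has a support point at which some normal is negative
on the position vector. It is found by applying Ekeland's principle to the norm. -/
theorem exists_mem_normalCone_apply_neg [CompleteSpace X] {A : Set X} (hA : IsClosed A)
    (hconv : Convex ℝ A) (hne : A.Nonempty) (h0 : (0 : X) ∉ A) :
    ∃ y, ∃ n ∈ normalCone A y, n y < 0 := by
  obtain ⟨y, hy, hmin⟩ := exists_norm_le_norm_add_half_norm_sub hA hne
  have hnorm : ∀ w : X, ∀ a b : ℝ, 0 ≤ a → 0 ≤ b → a + b = 1 → ∀ x x' : X,
      ‖a • x + b • x' - w‖ ≤ a * ‖x - w‖ + b * ‖x' - w‖ := by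
    intro w a b ha hb hab x x'
    have h := norm_add_le (a • (x - w)) (b • (x' - w))
    rw [norm_smul, norm_smul, Real.norm_of_nonneg ha, Real.norm_of_nonneg hb] at h
    rwa [smul_sub, smul_sub, sub_add_sub_comm, ← add_smul, hab, one_smul] at h
  have hF : ConvexOn ℝ (A ×ˢ Set.univ)
      fun e : X × X => ‖e.2‖ + 1 / 2 * ‖e.2 - y‖ - ‖y‖ := by
    refine ⟨hconv.prod convex_univ, fun e _ e' _ a b ha hb hab => ?_⟩
    have h1 := hnorm 0 a b ha hb hab e.2 e'.2
    have h2 := hnorm y a b ha hb hab e.2 e'.2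
    simp only [sub_zero] at h1
    simp only [Prod.snd_add, Prod.smul_snd, smul_eq_mul]
    have h3 : ‖y‖ = a * ‖y‖ + b * ‖y‖ := by rw [← add_mul, hab, one_mul]
    linarith
  obtain ⟨p, hp⟩ := exists_dual_comp_le hF
    (LinearMap.fst ℝ X X - LinearMap.snd ℝ X X) ⊤ (fun _ _ => trivial) (fun e he h => by
      have : e.1 = e.2 := by simpa [sub_eq_zero] using h
      have := hmin e.2 (this ▸ he.1)
      linarith) (ρ := 1) (K := 2) one_pos (fun v _ hv =>
      ⟨(y, y - v), ⟨hy, trivial⟩, by simp, by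
        have := norm_sub_le y v
        simp only [sub_sub_cancel_left, norm_neg]
        linarith⟩)
  have hp' : ∀ z ∈ A, ∀ w, p (z - w) ≤ ‖w‖ + 1 / 2 * ‖w - y‖ - ‖y‖ := fun z hz w => by
    simpa using hp (z, w) ⟨hz, trivial⟩
  refine ⟨y, p, ⟨hy, fun z hz => by simpa using hp' z hz y⟩, ?_⟩
  have h1 := hp' y hy 0
  have h2 : 0 < ‖y‖ := norm_pos_iff.2 fun h => h0 (h ▸ hy)
  simp only [sub_zero, norm_zero, zero_sub, norm_neg] at h1
  linarith

/-- The Attouch–Brezis sum rule for the normal cones of two closed convex sets. -/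
theorem exists_add_eq_of_mem_normalCone_inter [CompleteSpace X] {D C : Set X} (hD : IsClosed D)
    (hDc : Convex ℝ D) (hC : IsClosed C) (hCc : Convex ℝ C) (V : Submodule ℝ X)
    (hVc : IsClosed (V : Set X)) (hV : ∀ z ∈ D, ∀ c ∈ C, z - c ∈ V)
    (habs : ∀ v ∈ V, ∃ r > (0 : ℝ), ∃ z ∈ D, ∃ c ∈ C, v = r • (z - c)) {y : X}
    {n : StrongDual ℝ X} (hn : n ∈ normalCone (D ∩ C) y) :
    ∃ n₁ ∈ normalCone D y, ∃ n₂ ∈ normalCone C y, n₁ + n₂ = n := by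
  obtain ⟨ρ, hρ, N, hN⟩ := exists_ball_subset_image (hD.prod hC) (hDc.prod hCc)
    (ContinuousLinearMap.fst ℝ X X - ContinuousLinearMap.snd ℝ X X) V hVc
    (fun e he => hV _ he.1 _ he.2) (fun v hv => by
      obtain ⟨r, hr, z, hz, c, hc, h⟩ := habs v hv
      exact ⟨r, hr, (z, c), ⟨hz, hc⟩, h⟩)
  have hF : ConvexOn ℝ (D ×ˢ C) fun e : X × X => -n (e.1 - y) := by
    refine ⟨hDc.prod hCc, fun e _ e' _ a b _ _ hab => le_of_eq ?_⟩
    simp only [Prod.fst_add, Prod.smul_fst, map_sub, map_add, map_smul, smul_eq_mul]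
    linear_combination -(n y) * hab
  obtain ⟨p, hp⟩ := exists_dual_comp_le hF
    (LinearMap.fst ℝ X X - LinearMap.snd ℝ X X) V (fun e he => hV _ he.1 _ he.2) (fun e he h => by
      have : e.1 = e.2 := by simpa [sub_eq_zero] using h
      have := hn.2 e.1 ⟨he.1, this ▸ he.2⟩
      linarith) (K := ‖n‖ * (N + ‖y‖)) hρ (fun v hv hvρ => by
      obtain ⟨e, he, heN, hev⟩ := hN v hv hvρ
      refine ⟨e, he, hev, (neg_le_abs _).trans ((n.le_opNorm _).trans ?_)⟩
      have h1 := norm_sub_le e.1 y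
      have h2 := norm_fst_le e
      gcongr
      linarith)
  have hp' : ∀ z ∈ D, ∀ c ∈ C, p (z - c) ≤ -n (z - y) := fun z hz c hc => hp (z, c) ⟨hz, hc⟩
  refine ⟨n + p, ⟨hn.1.1, fun z hz => ?_⟩, -p, ⟨hn.1.2, fun c hc => ?_⟩, by abel⟩
  · have := hp' z hz y hn.1.2
    rw [add_apply]
    linarith
  · have := hp' y hn.1.1 c hc
    rw [sub_self, map_zero, ← neg_sub c y, map_neg] at this
    simpa using this

/-- If `C` contains a ball around `a` and `q = θ • a + e` is a boundary point of `C` with `e` small,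
while `q` is not close to `0`, then `C` has a normal at `q` that is negative at `q`. -/
theorem exists_mem_normalCone_apply_neg_of_near_segment {C : Set X} (hC : Convex ℝ C) {a q e : X}
    {θ r d δ : ℝ} (hr : 0 < r) (hball : Metric.closedBall a r ⊆ C) (hqC : q ∈ C)
    (hq : q ∉ interior C) (hθ : 0 ≤ θ) (hθ1 : θ ≤ 1) (hqe : q = θ • a + e) (he : ‖e‖ ≤ δ) (hdq : d ≤ ‖q‖)
    (hδr : δ < r) (hδ : δ * ‖a‖ < (d - δ) * (r - δ)) :
    ∃ n ∈ normalCone C q, n q < 0 := by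
  have ha : a ∈ interior C :=
    interior_mono hball (Metric.ball_subset_interior_closedBall (Metric.mem_ball_self hr))
  obtain ⟨c, hc0, hc⟩ := geometric_hahn_banach_of_nonempty_interior_point hC hq ⟨a, ha⟩
  refine ⟨c, ⟨hqC, fun y hy => by rw [map_sub]; linarith [hc y hy]⟩, ?_⟩
  have hcpos : 0 < ‖c‖ := norm_pos_iff.2 hc0
  have hside : ∀ u, ‖u‖ ≤ r → c u ≤ c (q - a) := fun u hu => by
    have := hc (a + u) (hball (by simpa using hu))
    rw [map_add] at this
    rw [map_sub]
    linarith
  have hκ : 0 ≤ c (q - a) := by simpa using hside 0 (by simpa using hr.le)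
  have hscale : ∀ x : X, r * c x ≤ c (q - a) * ‖x‖ := by
    intro x
    rcases eq_or_ne x 0 with rfl | hx
    · simp
    · have hxp : 0 < ‖x‖ := norm_pos_iff.2 hx
      have := hside ((r / ‖x‖) • x) (by
        rw [norm_smul, Real.norm_of_nonneg (by positivity), div_mul_cancel₀ _ hxp.ne'])
      rwa [map_smul, smul_eq_mul, div_mul_eq_mul_div, div_le_iff₀ hxp] at this
  have hnorm : r * ‖c‖ ≤ c (q - a) := by
    rw [mul_comm, ← le_div_iff₀ hr]
    refine c.opNorm_le_bound (by positivity) fun x => ?_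
    rw [div_mul_eq_mul_div, le_div_iff₀ hr, mul_comm, Real.norm_eq_abs]
    rcases abs_cases (c x) with ⟨h, -⟩ | ⟨h, -⟩
    · rw [h]; exact hscale x
    · rw [h]; simpa using hscale (-x)
  have hce : |c e| ≤ ‖c‖ * δ := (c.le_opNorm e).trans (by gcongr)
  have hcq : c q = θ * c a + c e := by rw [hqe]; simp
  rw [map_sub, hcq] at hnorm
  have h1 : (1 - θ) * c a ≤ -((r - δ) * ‖c‖) := by nlinarith [le_abs_self (c e)]
  have h2 : 0 < (r - δ) * ‖c‖ := mul_pos (by linarith) hcpos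
  have hca : c a ≤ -((r - δ) * ‖c‖) := by
    rcases le_or_gt (c a) 0 with h' | h' <;> nlinarith
  have hθa : d - δ ≤ θ * ‖a‖ := by
    have := norm_add_le (θ • a) e
    rw [← hqe, norm_smul, Real.norm_of_nonneg hθ] at this
    linarith
  have h3 : ‖a‖ * c q < 0 := calc
    ‖a‖ * c q = (θ * ‖a‖) * c a + ‖a‖ * c e := by rw [hcq]; ring
    _ ≤ (θ * ‖a‖) * -((r - δ) * ‖c‖) + ‖a‖ * (‖c‖ * δ) := by
      gcongr
      exact (le_abs_self _).trans hce
    _ = (δ * ‖a‖ - (θ * ‖a‖) * (r - δ)) * ‖c‖ := by ring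
    _ < 0 := by
      refine mul_neg_of_neg_of_pos ?_ hcpos
      nlinarith
  by_contra! h
  exact (mul_nonneg (norm_nonneg a) h).not_gt h3

end NormalCone

end MonotoneOperator

namespace MonotoneOperator

section Operators

variable {X : Type*} [NormedAddCommGroup X] [NormedSpace ℝ X]

/-! ### Maximal monotone operators and the Fitzpatrick function -/

theorem IsMonotone.nonneg {T : X → Set (StrongDual ℝ X)} (hT : IsMonotone T) {x y : X}
    {x' y' : StrongDual ℝ X} (hx : x' ∈ T x) (hy : y' ∈ T y) : 0 ≤ (x' - y') (x - y) :=
  hT (x, x') hx (y, y') hy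

/-- A monotone operator is maximal if and only if it contains all points that are monotonically
related to its graph. -/
theorem isMaximalMonotone_iff {T : X → Set (StrongDual ℝ X)} :
    IsMaximalMonotone T ↔ IsMonotone T ∧
      ∀ x x', (∀ y, ∀ y' ∈ T y, 0 ≤ (x' - y') (x - y)) → x' ∈ T x := by
  refine ⟨fun h => ⟨h.1, fun x x' hx => ?_⟩, fun h => ⟨h.1, ?_⟩⟩
  · by_contra hn
    refine h.2 ⟨fun y => {y' | y' ∈ T y ∨ (y = x ∧ y' = x')}, ?_, ?_⟩
    · rintro ⟨y, y'⟩ (hy | ⟨rfl, rfl⟩) ⟨z, z'⟩ (hz | ⟨rfl, rfl⟩)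
      · exact h.1.nonneg hy hz
      · have := hx y y' hy
        rwa [← neg_sub y' _, ← neg_sub y _, map_neg, neg_apply, neg_neg] at this
      · exact hx z z' hz
      · simp
    · exact ⟨fun p hp => Or.inl hp, fun hsub => hn (hsub (a := (x, x')) (Or.inr ⟨rfl, rfl⟩))⟩
  · rintro ⟨S, hS, hsub, hne⟩
    exact hne fun p hp => h.2 p.1 p.2 fun y y' hy => hS.nonneg hp (hsub (a := (y, y')) hy)

theorem IsMaximalMonotone.mem {T : X → Set (StrongDual ℝ X)} (hT : IsMaximalMonotone T) {x : X}
    {x' : StrongDual ℝ X} (h : ∀ y, ∀ y' ∈ T y, 0 ≤ (x' - y') (x - y)) : x' ∈ T x :=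
  (isMaximalMonotone_iff.1 hT).2 x x' h

theorem IsMaximalMonotone.add_mem {T : X → Set (StrongDual ℝ X)} (hT : IsMaximalMonotone T) {x : X}
    {x' n : StrongDual ℝ X} (hx : x' ∈ T x) (hn : n ∈ normalCone (dom T) x) : x' + n ∈ T x :=
  hT.mem fun y y' hy => by
    have h1 := hT.1.nonneg hx hy
    have h2 := hn.2 y ⟨y', hy⟩
    rw [← neg_sub, map_neg] at h2
    rw [add_sub_right_comm, add_apply]
    linarith

theorem isMonotone_add_normalCone {T : X → Set (StrongDual ℝ X)} (hT : IsMonotone T) (C : Set X) :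
    IsMonotone (T + normalCone C) := by
  rintro ⟨x, x'⟩ ⟨a, ha, n, hn, rfl⟩ ⟨y, y'⟩ ⟨b, hb, m, hm, rfl⟩
  have h1 := hT.nonneg ha hb
  have h2 := hn.2 y hm.1
  have h3 := hm.2 x hn.1
  simp only [map_sub, sub_apply, add_apply] at *
  linarith

/-- The epigraph of the Fitzpatrick function
`(x, x*) ↦ sup {⟨x*, w⟩ + ⟨w*, x⟩ - ⟨w*, w⟩ | w* ∈ T w}` of `T`. -/
def fitzpatrickEpigraph (T : X → Set (StrongDual ℝ X)) : Set (X × StrongDual ℝ X × ℝ) :=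
  {q | ∀ w, ∀ w' ∈ T w, q.2.1 w + w' q.1 - w' w ≤ q.2.2}

theorem isClosed_fitzpatrickEpigraph (T : X → Set (StrongDual ℝ X)) :
    IsClosed (fitzpatrickEpigraph T) := by
  simp only [fitzpatrickEpigraph, Set.ofPred_forall]
  refine isClosed_iInter fun w => isClosed_iInter fun w' => isClosed_iInter fun _ =>
    isClosed_le ?_ ?_ <;> fun_prop

theorem convex_fitzpatrickEpigraph (T : X → Set (StrongDual ℝ X)) :
    Convex ℝ (fitzpatrickEpigraph T) := by
  rintro ⟨x, x', s⟩ hx ⟨y, y', t⟩ hy a b ha hb hab w w' hw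
  have h1 := mul_le_mul_of_nonneg_left (hx w w' hw) ha
  have h2 := mul_le_mul_of_nonneg_left (hy w w' hw) hb
  simp only [Prod.smul_mk, Prod.mk_add_mk, add_apply, smul_apply, map_add, map_smul, smul_eq_mul]
  have h3 : w' w = a * w' w + b * w' w := by rw [← add_mul, hab, one_mul]
  simp only at h1 h2
  linarith

theorem IsMonotone.mem_fitzpatrickEpigraph {T : X → Set (StrongDual ℝ X)} (hT : IsMonotone T)
    {x : X} {x' : StrongDual ℝ X} (hx : x' ∈ T x) : (x, x', x' x) ∈ fitzpatrickEpigraph T := by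
  intro w w' hw
  have := hT.nonneg hx hw
  simp only [map_sub, sub_apply] at *
  linarith

/-- If the Fitzpatrick function of `T` is at least `-M * ‖·‖` over `dom T ∩ C`, and if small vectors
of the subspace `V` are differences `z - y` with `z ∈ dom T` and `y ∈ C` at bounded cost, then some
element of `T 0 + N_C 0` has norm at most `M`. The multiplier for the constraint `z = y` is the
element of `T 0`. -/
theorem IsMaximalMonotone.exists_norm_add_le {T : X → Set (StrongDual ℝ X)}
    (hT : IsMaximalMonotone T) (hD : Convex ℝ (dom T)) {C : Set X} (hC : Convex ℝ C)
    (h0 : (0 : X) ∈ C) {M : ℝ} (hM : 0 ≤ M)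
    (hfitz : ∀ y ∈ dom T ∩ C, ∀ y' s, (y, y', s) ∈ fitzpatrickEpigraph T → -(M * ‖y‖) ≤ s)
    (V : Submodule ℝ X) (hV : ∀ z ∈ dom T, ∀ y ∈ C, z - y ∈ V) {ρ K : ℝ} (hρ : 0 < ρ)
    (hb : ∀ v ∈ V, ‖v‖ < ρ → ∃ z ∈ dom T, ∃ z' s, (z, z', s) ∈ fitzpatrickEpigraph T ∧
      ∃ y ∈ C, z - y = v ∧ s + M * ‖y‖ ≤ K) :
    ∃ u ∈ T 0, ∃ n ∈ normalCone C 0, ‖u + n‖ ≤ M := by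
  set Γ : Set ((X × StrongDual ℝ X × ℝ) × X) :=
    (fitzpatrickEpigraph T ∩ Prod.fst ⁻¹' dom T) ×ˢ C with hΓ
  have hF : ConvexOn ℝ Γ fun e => e.1.2.2 + M * ‖e.2‖ := by
    refine ⟨((convex_fitzpatrickEpigraph T).inter
      (hD.linear_preimage (LinearMap.fst ℝ X (StrongDual ℝ X × ℝ)))).prod hC,
      fun e _ e' _ a b ha hb _ => ?_⟩
    have h := norm_add_le (a • e.2) (b • e'.2)
    rw [norm_smul, norm_smul, Real.norm_of_nonneg ha, Real.norm_of_nonneg hb] at h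
    have := mul_le_mul_of_nonneg_left h hM
    simp only [Prod.fst_add, Prod.smul_fst, Prod.snd_add, Prod.smul_snd, smul_eq_mul]
    linarith
  obtain ⟨p, hp⟩ := exists_dual_comp_le hF
    (LinearMap.fst ℝ X (StrongDual ℝ X × ℝ) ∘ₗ LinearMap.fst ℝ (X × StrongDual ℝ X × ℝ) X
      - LinearMap.snd ℝ (X × StrongDual ℝ X × ℝ) X) V
    (fun e he => hV _ he.1.2 _ he.2) (fun e he h => by
      have h : e.1.1 = e.2 := by simpa [sub_eq_zero] using h
      have := hfitz e.1.1 ⟨he.1.2, h ▸ he.2⟩ _ _ he.1.1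
      rw [h] at this
      linarith) hρ (fun v hv hvρ => by
      obtain ⟨z, hz, z', s, hs, y, hy, hzy, hK⟩ := hb v hv hvρ
      exact ⟨((z, z', s), y), ⟨⟨hs, hz⟩, hy⟩, hzy, hK⟩)
  have hp' : ∀ z, ∀ z' ∈ T z, ∀ y ∈ C, p (z - y) ≤ z' z + M * ‖y‖ := fun z z' hz y hy =>
    hp ((z, z', z' z), y) ⟨⟨hT.1.mem_fitzpatrickEpigraph hz, ⟨z', hz⟩⟩, hy⟩
  have hp0 : p ∈ T 0 := hT.mem fun z z' hz => by
    have := hp' z z' hz 0 h0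
    simp only [sub_zero, norm_zero, mul_zero, add_zero] at this
    simp only [zero_sub, map_neg, sub_apply]
    linarith
  obtain ⟨n, hn, hle⟩ := exists_mem_normalCone_norm_add_le hC h0 hM (u := p) fun y hy => by
    have := hp' 0 p hp0 y hy
    simp only [zero_sub, map_neg, map_zero, zero_add] at this
    linarith
  exact ⟨p, hp0, n, hn, hle⟩

theorem le_of_forall_mul_add_one_sub_mul_le {a b s : ℝ}
    (h : ∀ t, 0 < t → t < 1 → t * a + (1 - t) * b ≤ s) : b ≤ s := by
  have hlim : Filter.Tendsto (fun t : ℝ => t * a + (1 - t) * b) (nhdsWithin 0 (Set.Ioi 0))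
      (nhds b) := by
    have : Continuous fun t : ℝ => t * a + (1 - t) * b := by fun_prop
    simpa using (this.tendsto 0).mono_left nhdsWithin_le_nhds
  refine le_of_tendsto hlim ?_
  filter_upwards [Ioo_mem_nhdsGT (zero_lt_one' ℝ)] with t ht using h t ht.1 ht.2

/-! ### Closed convex domains -/

/-- Under the closed-subspace condition, a point that is related to `T + N_C` up to `M * ‖·‖` lies
in `dom T ∩ C`: otherwise the normals of this set yield arbitrarily negative values, and they can be
split between `T` and `N_C`. -/
theorem IsMaximalMonotone.zero_mem_dom_inter [CompleteSpace X] {T : X → Set (StrongDual ℝ X)}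
    (hT : IsMaximalMonotone T) (hDcl : IsClosed (dom T)) (hD : Convex ℝ (dom T)) {C : Set X}
    (hCcl : IsClosed C) (hC : Convex ℝ C) (V : Submodule ℝ X) (hVc : IsClosed (V : Set X))
    (hV : ∀ z ∈ dom T, ∀ y ∈ C, z - y ∈ V)
    (habs : ∀ v ∈ V, ∃ r > (0 : ℝ), ∃ z ∈ dom T, ∃ y ∈ C, v = r • (z - y)) {M : ℝ}
    (hH : ∀ y, ∀ y' ∈ T y, ∀ n ∈ normalCone C y, 0 ≤ (y' + n) y + M * ‖y‖) :
    (0 : X) ∈ dom T ∩ C := by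
  by_contra h0
  have hne : (dom T ∩ C).Nonempty := by
    obtain ⟨r, hr, z, hz, y, hy, h⟩ := habs 0 V.zero_mem
    have : z = y := sub_eq_zero.1 ((smul_eq_zero.1 h.symm).resolve_left hr.ne')
    exact ⟨z, hz, this ▸ hy⟩
  obtain ⟨y, n, hn, hneg⟩ :=
    exists_mem_normalCone_apply_neg (hDcl.inter hCcl) (hD.inter hC) hne h0
  obtain ⟨n₁, hn₁, n₂, hn₂, rfl⟩ :=
    exists_add_eq_of_mem_normalCone_inter hDcl hD hCcl hC V hVc hV habs hn
  obtain ⟨y', hy'⟩ := hn.1.1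
  obtain ⟨k, hk⟩ := exists_nat_gt ((y' y + M * ‖y‖) / -(n₁ + n₂) y)
  have hk0 : (0 : ℝ) ≤ k := k.cast_nonneg
  rw [div_lt_iff₀ (by linarith)] at hk
  have := hH y _ (hT.add_mem hy' (smul_mem_normalCone hn₁ hk0)) _ (smul_mem_normalCone hn₂ hk0)
  simp only [add_apply, smul_apply, smul_eq_mul] at this hk
  linarith

theorem IsMaximalMonotone.exists_norm_add_le_of_isClosed_dom [CompleteSpace X]
    {T : X → Set (StrongDual ℝ X)} (hT : IsMaximalMonotone T) (hDcl : IsClosed (dom T))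
    (hD : Convex ℝ (dom T)) {C : Set X} (hCcl : IsClosed C) (hC : Convex ℝ C)
    (V : Submodule ℝ X) (hVc : IsClosed (V : Set X)) (hV : ∀ z ∈ dom T, ∀ y ∈ C, z - y ∈ V)
    (habs : ∀ v ∈ V, ∃ r > (0 : ℝ), ∃ z ∈ dom T, ∃ y ∈ C, v = r • (z - y)) {M : ℝ} (hM : 0 ≤ M)
    (hH : ∀ y, ∀ y' ∈ T y, ∀ n ∈ normalCone C y, 0 ≤ (y' + n) y + M * ‖y‖) :
    ∃ u ∈ T 0, ∃ n ∈ normalCone C 0, ‖u + n‖ ≤ M := by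
  have h0 := hT.zero_mem_dom_inter hDcl hD hCcl hC V hVc hV habs hH
  obtain ⟨ρ, hρ, N, hN⟩ := exists_ball_subset_image
    (((isClosed_fitzpatrickEpigraph T).inter (hDcl.preimage continuous_fst)).prod hCcl)
    (((convex_fitzpatrickEpigraph T).inter
      (hD.linear_preimage (LinearMap.fst ℝ X (StrongDual ℝ X × ℝ)))).prod hC)
    (ContinuousLinearMap.fst ℝ X (StrongDual ℝ X × ℝ) ∘L
      ContinuousLinearMap.fst ℝ (X × StrongDual ℝ X × ℝ) X
      - ContinuousLinearMap.snd ℝ (X × StrongDual ℝ X × ℝ) X) V hVc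
    (fun e he => hV _ he.1.2 _ he.2) (fun v hv => by
      obtain ⟨r, hr, z, ⟨z', hz⟩, y, hy, h⟩ := habs v hv
      exact ⟨r, hr, ((z, z', z' z), y), ⟨⟨hT.1.mem_fitzpatrickEpigraph hz, ⟨z', hz⟩⟩, hy⟩, h⟩)
  refine hT.exists_norm_add_le hD hC h0.2 hM (fun y hy y' s hs => ?_) V hV hρ (K := N + M * N)
    fun v hv hvρ => ?_
  · -- Testing with a point of the graph over `t • y` and letting `t` tend to `0`.
    refine le_of_forall_mul_add_one_sub_mul_le (a := y' y) fun t ht ht1 => ?_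
    have hmem : t • y ∈ dom T ∩ C :=
      (hD.inter hC).smul_mem_of_zero_mem h0 hy ⟨ht.le, ht1.le⟩
    obtain ⟨w', hw'⟩ := hmem.1
    have h1 := hs _ w' hw'
    have h2 := hH _ w' hw' 0 (zero_mem_normalCone hmem.2)
    rw [add_zero, norm_smul, Real.norm_of_nonneg ht.le] at h2
    simp only [map_smul, smul_eq_mul] at h1 h2
    have h3 : 0 ≤ w' y + M * ‖y‖ := by
      refine nonneg_of_mul_nonneg_right (a := t) ?_ ht
      linarith
    nlinarith [mul_nonneg (sub_nonneg.2 ht1.le) h3]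
  · obtain ⟨⟨⟨z, z', s⟩, y⟩, he, heN, hev⟩ := hN v hv hvρ
    refine ⟨z, he.1.2, z', s, he.1.1, y, he.2, hev, ?_⟩
    have hy : ‖y‖ ≤ N := (norm_snd_le _).trans heN
    have hs : s ≤ N := (le_abs_self s).trans
      ((((norm_snd_le (z', s)).trans (norm_snd_le (z, z', s))).trans
        (norm_fst_le ((z, z', s), y))).trans heN)
    gcongr

end Operators

end MonotoneOperator

namespace MonotoneOperator

section FPV

variable {X : Type*} [NormedAddCommGroup X] [NormedSpace ℝ X]

/-! ### Operators of type (FPV) -/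

/-- If `T` is of type (FPV) and `0` is related to `T + N_C` up to `M * ‖·‖`, then `0` is in the
closure of `dom T ∩ C`. Otherwise, by the existence of negative normals, `dom T` has no point
outside `C` in a thin neighbourhood of a segment from `0` to `dom T ∩ interior C`, and the defining
property of type (FPV) for this neighbourhood applies to a multiple of a functional that separates
`0` from `dom T ∩ C`. -/
theorem IsFPV.zero_mem_closure {T : X → Set (StrongDual ℝ X)} (hT : IsFPV T)
    (hD : Convex ℝ (dom T)) {C : Set X} (hCcl : IsClosed C) (hC : Convex ℝ C)
    (hint : (dom T ∩ interior C).Nonempty) {M : ℝ} (hM : 0 ≤ M)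
    (hH : ∀ y, ∀ y' ∈ T y, ∀ n ∈ normalCone C y, 0 ≤ (y' + n) y + M * ‖y‖) :
    (0 : X) ∈ closure (dom T ∩ C) := by
  by_contra h0
  obtain ⟨a, haD, haC⟩ := hint
  obtain ⟨d, hd, hdA⟩ : ∃ d > 0, ∀ q ∈ dom T ∩ C, d ≤ ‖q‖ := by
    simp only [Metric.mem_closure_iff, not_forall, not_exists, not_and, not_lt] at h0
    obtain ⟨d, hd, h⟩ := h0
    exact ⟨d, hd, fun q hq => by simpa using h q hq⟩
  obtain ⟨r, hr, hball⟩ := Metric.nhds_basis_closedBall.mem_iff.1 (mem_interior_iff_mem_nhds.1 haC)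
  have ha : 0 < ‖a‖ := hd.trans_le (hdA a ⟨haD, interior_subset haC⟩)
  obtain ⟨δ, hδ, hδr, hδa⟩ : ∃ δ > 0, δ < r ∧ δ * ‖a‖ < (d - δ) * (r - δ) := by
    refine ⟨d * r / (‖a‖ + d + r), by positivity, ?_, ?_⟩
    · rw [div_lt_iff₀ (by positivity)]
      nlinarith
    · have h : d * r / (‖a‖ + d + r) * (‖a‖ + d + r) = d * r := div_mul_cancel₀ _ (by positivity)
      have : 0 < d * r / (‖a‖ + d + r) := by positivity
      nlinarith
  set U := Metric.thickening δ (segment ℝ 0 a) with hU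
  have hUconv : Convex ℝ U := (convex_segment 0 a).thickening δ
  have hUmem : ∀ q ∈ U, ∃ θ : ℝ, ∃ e, 0 ≤ θ ∧ θ ≤ 1 ∧ q = θ • a + e ∧ ‖e‖ ≤ δ := by
    intro q hq
    obtain ⟨z, ⟨s, θ, hs, hθ, hsθ, rfl⟩, hz⟩ := Metric.mem_thickening_iff.1 hq
    rw [smul_zero, zero_add, dist_eq_norm] at hz
    exact ⟨θ, q - θ • a, hθ, by linarith, by abel, hz.le⟩
  have haU : a ∈ U := Metric.self_subset_thickening hδ _ (right_mem_segment ℝ 0 a)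
  have h0U : (0 : X) ∈ U := Metric.self_subset_thickening hδ _ (left_mem_segment ℝ 0 a)
  -- No boundary point of `C` in `U` lies in `dom T`, since multiples of normals would violate `hH`.
  have hbdry : ∀ q ∈ U ∩ dom T, q ∈ C → q ∈ interior C := by
    rintro q ⟨hqU, hqD⟩ hqC
    by_contra hq
    obtain ⟨θ, e, hθ, hθ1, hqe, he⟩ := hUmem q hqU
    obtain ⟨n, hn, hneg⟩ := exists_mem_normalCone_apply_neg_of_near_segment hC hr hball hqC hq hθ
      hθ1 hqe he (hdA q ⟨hqD, hqC⟩) hδr hδa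
    obtain ⟨q', hq'⟩ := hqD
    obtain ⟨k, hk⟩ := exists_nat_gt ((q' q + M * ‖q‖) / -n q)
    rw [div_lt_iff₀ (by linarith)] at hk
    have := hH q q' hq' _ (smul_mem_normalCone hn k.cast_nonneg)
    simp only [add_apply, smul_apply, smul_eq_mul] at this
    linarith
  have hUC : U ∩ dom T ⊆ C := by
    intro q hq
    by_contra hqC
    have hseg : segment ℝ a q ⊆ U ∩ dom T := (hUconv.inter hD).segment_subset ⟨haU, haD⟩ hq
    obtain ⟨x, -, hx, hx'⟩ := (convex_segment a q).isPreconnected (interior C) Cᶜ isOpen_interior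
      hCcl.isOpen_compl (fun x hx => (em (x ∈ C)).imp (hbdry x (hseg hx)) id)
      ⟨a, left_mem_segment ℝ a q, haC⟩ ⟨q, right_mem_segment ℝ a q, hqC⟩
    exact hx' (interior_subset hx)
  obtain ⟨f, u, hf0, hf⟩ :=
    geometric_hahn_banach_point_closed (hD.inter hC).closure isClosed_closure h0
  rw [map_zero] at hf0
  have hmem : (0, -((M * (‖a‖ + δ) / u) • f)) ∈ graph T := by
    refine hT.2 U Metric.isOpen_thickening hUconv ⟨a, haU, haD⟩ 0 h0U _ ?_
    rintro ⟨y, y'⟩ hy hyU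
    have hyC : y ∈ C := hUC ⟨hyU, ⟨y', hy⟩⟩
    have h1 := hH y y' hy 0 (zero_mem_normalCone hyC)
    have h2 : M * (‖a‖ + δ) ≤ M * (‖a‖ + δ) / u * f y := by
      rw [div_mul_eq_mul_div, le_div_iff₀ hf0]
      exact mul_le_mul_of_nonneg_left (hf y (subset_closure ⟨⟨y', hy⟩, hyC⟩)).le (by positivity)
    have h3 : ‖y‖ ≤ ‖a‖ + δ := by
      obtain ⟨θ, e, hθ, hθ1, rfl, he⟩ := hUmem y hyU
      refine (norm_add_le _ _).trans (add_le_add ?_ he)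
      rw [norm_smul, Real.norm_of_nonneg hθ]
      exact mul_le_of_le_one_left ha.le hθ1
    have h4 := mul_le_mul_of_nonneg_left h3 hM
    rw [add_zero] at h1
    simp only [zero_sub, map_neg, sub_apply, neg_apply, smul_apply, smul_eq_mul]
    linarith
  have h0D : (0 : X) ∈ dom T := ⟨_, hmem⟩
  exact h0 (subset_closure ⟨h0D, hUC ⟨h0U, h0D⟩⟩)

/-- The lower bound for the Fitzpatrick function at interior points of `C`. The points `t • y` need
not belong to `dom T`, but type (FPV) provides a point `(b, b*)` of the graph with `b` close to
`t • y` and `⟨b*, t • y - b⟩ ≥ 0`. -/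
theorem IsFPV.neg_mul_norm_le_of_mem_interior {T : X → Set (StrongDual ℝ X)} (hT : IsFPV T)
    (hD : Convex ℝ (dom T)) {C : Set X} (hC : Convex ℝ C) (h0C : (0 : X) ∈ C)
    (h0D : (0 : X) ∈ closure (dom T)) {M : ℝ} (hM : 0 ≤ M)
    (hH : ∀ y, ∀ y' ∈ T y, y ∈ C → 0 ≤ y' y + M * ‖y‖) {y : X} (hyD : y ∈ dom T)
    (hyC : y ∈ interior C) {y' : StrongDual ℝ X} {s : ℝ}
    (hs : (y, y', s) ∈ fitzpatrickEpigraph T) : -(M * ‖y‖) ≤ s := by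
  refine le_of_forall_mul_add_one_sub_mul_le (a := y' y) fun t ht ht1 => ?_
  have hpC : t • y ∈ interior C := by
    have := hC.combo_self_interior_mem_interior h0C hyC (sub_nonneg.2 ht1.le) ht (by ring)
    simpa using this
  have hpD : t • y ∈ closure (dom T) :=
    hD.closure.smul_mem_of_zero_mem h0D (subset_closure hyD) ⟨ht.le, ht1.le⟩
  have hnear : ∀ ε > 0, ∃ b ∈ C, ‖b - t • y‖ < ε ∧ ∃ b' ∈ T b, b' b ≤ b' (t • y) := by
    intro ε hε
    by_cases hp : t • y ∈ dom T
    · obtain ⟨b', hb'⟩ := hp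
      exact ⟨t • y, interior_subset hpC, by simpa using hε, b', hb', le_rfl⟩
    · by_contra! hcon
      refine hp ⟨0, hT.2 (Metric.ball (t • y) ε ∩ interior C)
        (Metric.isOpen_ball.inter isOpen_interior) ((convex_ball _ _).inter hC.interior) ?_ _
        ⟨Metric.mem_ball_self hε, hpC⟩ 0 ?_⟩
      · exact mem_closure_iff.1 hpD _ (Metric.isOpen_ball.inter isOpen_interior)
          ⟨Metric.mem_ball_self hε, hpC⟩
      · rintro ⟨b, b'⟩ hb ⟨hbε, hbC⟩
        have := hcon b (interior_subset hbC) (by simpa [dist_eq_norm] using hbε) b' hb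
        simp only [zero_sub, neg_apply, map_sub]
        linarith
  have key : t * (t * y' y + (1 - t) * -(M * ‖y‖)) ≤ t * s := by
    refine le_of_forall_pos_le_add fun η hη => ?_
    obtain ⟨b, hbC, hbε, b', hb', hbb⟩ := hnear (η / (‖y'‖ + M + 1)) (by positivity)
    rw [lt_div_iff₀ (by positivity)] at hbε
    have h1 := mul_le_mul_of_nonneg_left (hs b b' hb') ht.le
    have h2 := hH b b' hb' hbC
    have h3 : y' (t • y) - ‖y'‖ * ‖b - t • y‖ ≤ y' b := by
      have := (neg_le_abs _).trans (y'.le_opNorm (b - t • y))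
      rw [map_sub] at this
      linarith
    have h4 : ‖b‖ ≤ t * ‖y‖ + ‖b - t • y‖ := by
      have := norm_add_le (t • y) (b - t • y)
      rwa [add_sub_cancel, norm_smul, Real.norm_of_nonneg ht.le] at this
    simp only [map_smul, smul_eq_mul] at hbb h1 h3
    have h5 := mul_le_mul_of_nonneg_left h4 hM
    have h6 : (1 - t) * -(M * (t * ‖y‖ + ‖b - t • y‖)) ≤ (1 - t) * b' b :=
      mul_le_mul_of_nonneg_left (by linarith) (sub_nonneg.2 ht1.le)
    have h7 := mul_le_mul_of_nonneg_left h3 ht.le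
    have h8 : 0 ≤ ‖b - t • y‖ := norm_nonneg _
    have h9 : t * (‖y'‖ * ‖b - t • y‖) ≤ 1 * (‖y'‖ * ‖b - t • y‖) := by gcongr
    have h10 : (1 - t) * (M * ‖b - t • y‖) ≤ 1 * (M * ‖b - t • y‖) := by
      gcongr
      linarith
    linarith
  exact le_of_mul_le_mul_left key ht

theorem IsFPV.exists_norm_add_le {T : X → Set (StrongDual ℝ X)} (hT : IsFPV T)
    (hD : Convex ℝ (dom T)) {C : Set X} (hCcl : IsClosed C) (hC : Convex ℝ C)
    (hint : (dom T ∩ interior C).Nonempty) {M : ℝ} (hM : 0 ≤ M)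
    (hH : ∀ y, ∀ y' ∈ T y, ∀ n ∈ normalCone C y, 0 ≤ (y' + n) y + M * ‖y‖) :
    ∃ u ∈ T 0, ∃ n ∈ normalCone C 0, ‖u + n‖ ≤ M := by
  have h0 := hT.zero_mem_closure hD hCcl hC hint hM hH
  have h0C : (0 : X) ∈ C := closure_minimal Set.inter_subset_right hCcl h0
  have h0D : (0 : X) ∈ closure (dom T) := closure_mono Set.inter_subset_left h0
  have hH' : ∀ y, ∀ y' ∈ T y, y ∈ C → 0 ≤ y' y + M * ‖y‖ := fun y y' hy hyC => by
    simpa using hH y y' hy 0 (zero_mem_normalCone hyC)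
  obtain ⟨a, haD, haC⟩ := hint
  obtain ⟨a', ha'⟩ := haD
  have hae := hT.1.1.mem_fitzpatrickEpigraph ha'
  obtain ⟨ρ, hρ, hball⟩ := Metric.nhds_basis_ball.mem_iff.1 (mem_interior_iff_mem_nhds.1 haC)
  refine hT.1.exists_norm_add_le hD hC h0C hM (fun y hy y' s hs => ?_) ⊤
    (fun _ _ _ _ => trivial) hρ (K := a' a + M * (‖a‖ + ρ)) fun v _ hv => ?_
  · -- Boundary points of `C` are approached along the segment towards `a`.
    refine le_of_forall_mul_add_one_sub_mul_le (a := s - a' a - M * ‖a‖) fun t ht ht1 => ?_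
    have h1t : 0 ≤ 1 - t := sub_nonneg.2 ht1.le
    have h1 := hT.neg_mul_norm_le_of_mem_interior hD hC h0C h0D hM hH'
      (hD hy.1 ⟨a', ha'⟩ h1t ht.le (by ring))
      (hC.combo_self_interior_mem_interior hy.2 haC h1t ht (by ring))
      (convex_fitzpatrickEpigraph T hs hae h1t ht.le (by ring))
    have h2 := norm_add_le ((1 - t) • y) (t • a)
    rw [norm_smul, norm_smul, Real.norm_of_nonneg h1t, Real.norm_of_nonneg ht.le] at h2
    have h3 := mul_le_mul_of_nonneg_left h2 hM
    simp only [Prod.smul_mk, smul_eq_mul] at h1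
    linarith
  · refine ⟨a, ⟨a', ha'⟩, a', a' a, hae, a - v, hball (by simpa using hv), by abel, ?_⟩
    have := norm_sub_le a v
    gcongr
    linarith

end FPV

section Regularity

variable {X : Type*} [NormedAddCommGroup X] [NormedSpace ℝ X]

/-! ### Translation and regularity -/

/-- The operator whose graph is that of `T` translated by `-(x, x')`. -/
def translate (T : X → Set (StrongDual ℝ X)) (x : X) (x' : StrongDual ℝ X) :
    X → Set (StrongDual ℝ X) :=
  fun y => {y' | y' + x' ∈ T (y + x)}

theorem dom_translate (T : X → Set (StrongDual ℝ X)) (x : X) (x' : StrongDual ℝ X) :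
    dom (translate T x x') = (fun y => y + x) ⁻¹' dom T := by
  ext y
  exact ⟨fun ⟨y', hy⟩ => ⟨_, hy⟩, fun ⟨y', hy⟩ => ⟨y' - x', by simpa [translate] using hy⟩⟩

theorem IsMaximalMonotone.translate {T : X → Set (StrongDual ℝ X)} (hT : IsMaximalMonotone T)
    (x : X) (x' : StrongDual ℝ X) : IsMaximalMonotone (translate T x x') := by
  refine isMaximalMonotone_iff.2 ⟨?_, fun z z' hz => hT.mem fun y y' hy => ?_⟩
  · rintro ⟨y, y'⟩ hy ⟨z, z'⟩ hz
    simpa using hT.1.nonneg hy hz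
  · have := hz (y - x) (y' - x') (by simpa [MonotoneOperator.translate] using hy)
    rwa [sub_sub_eq_add_sub, sub_sub_eq_add_sub] at this

theorem IsFPV.translate {T : X → Set (StrongDual ℝ X)} (hT : IsFPV T) (x : X)
    (x' : StrongDual ℝ X) : IsFPV (translate T x x') := by
  refine ⟨hT.1.translate x x', fun U hU hUc hUD z hz z' hzz => ?_⟩
  refine hT.2 ((fun y => y - x) ⁻¹' U) (hU.preimage (by fun_prop)) ?_ ?_ (z + x)
    (by simpa using hz) (z' + x') ?_
  · simpa only [sub_eq_add_neg] using hUc.translate_preimage_left (-x)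
  · obtain ⟨y, hyU, hyD⟩ := hUD
    rw [dom_translate] at hyD
    exact ⟨y + x, by simpa using hyU, hyD⟩
  · rintro ⟨y, y'⟩ hy hyU
    have := hzz (y - x, y' - x') (by simpa [graph, MonotoneOperator.translate] using hy) hyU
    simpa only [sub_sub_eq_add_sub] using this

theorem mem_normalCone_preimage_add_iff {C : Set X} {x y : X} {n : StrongDual ℝ X} :
    n ∈ normalCone ((fun y => y + x) ⁻¹' C) y ↔ n ∈ normalCone C (y + x) := by
  refine and_congr Iff.rfl ⟨fun h z hz => ?_, fun h z hz => ?_⟩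
  · have := h (z - x) (by simpa using hz)
    rwa [sub_sub, add_comm x y] at this
  · simpa using h (z + x) hz

/-- A monotone operator `S` is maximal and regular if every point `(x, x*)` that satisfies
`⟨y* - x*, y - x⟩ ≥ -M * ‖y - x‖` on the graph is within distance `M` of `S x`. The case `M = 0`
gives maximality, and the case `M = L(x, x*, S)` regularity. -/
theorem IsMonotone.isRegularMaximalMonotone {S : X → Set (StrongDual ℝ X)} (hS : IsMonotone S)
    (h : ∀ M : ℝ, 0 ≤ M → ∀ x x', (∀ y, ∀ y' ∈ S y, 0 ≤ (y' - x') (y - x) + M * ‖y - x‖) →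
      ∃ s ∈ S x, ‖s - x'‖ ≤ M) : IsRegularMaximalMonotone S := by
  refine ⟨isMaximalMonotone_iff.2 ⟨hS, fun x x' hx => ?_⟩, fun x x' => le_antisymm ?_ ?_⟩
  · obtain ⟨s, hs, hle⟩ := h 0 le_rfl x x' fun y y' hy => by
      have := hx y y' hy
      rw [← neg_sub y' x', ← neg_sub y x, map_neg, neg_apply, neg_neg] at this
      linarith
    rwa [← sub_eq_zero.1 (norm_le_zero_iff.1 hle)]
  · refine iSup₂_le fun p hp => Metric.le_infEDist.2 fun s hs => ?_
    rw [edist_comm, edist_dist, dist_eq_norm]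
    refine ENNReal.ofReal_le_ofReal ?_
    have hpos : 0 < ‖x - p.1‖ := norm_pos_iff.2 (sub_ne_zero.2 (Ne.symm hp.2))
    rw [div_le_iff₀ hpos]
    have h1 := hS.nonneg hs hp.1
    have h2 := (le_abs_self _).trans ((s - x').le_opNorm (x - p.1))
    simp only [sub_apply] at *
    linarith
  · rcases eq_or_ne (L x x' S) ⊤ with htop | htop
    · rw [htop]
      exact le_top
    · obtain ⟨s, hs, hle⟩ := h (L x x' S).toReal ENNReal.toReal_nonneg x x' fun y y' hy => by
        rcases eq_or_ne y x with rfl | hyx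
        · simp
        · have hq : ENNReal.ofReal ((y' - x') (x - y) / ‖x - y‖) ≤ L x x' S :=
            le_iSup₂ (f := fun (p : X × StrongDual ℝ X) (_ : p ∈ {p ∈ graph S | p.1 ≠ x}) =>
              ENNReal.ofReal ((p.2 - x') (x - p.1) / ‖x - p.1‖)) (y, y') ⟨hy, hyx⟩
          have hpos : 0 < ‖x - y‖ := norm_pos_iff.2 (sub_ne_zero.2 hyx.symm)
          rw [ENNReal.ofReal_le_iff_le_toReal htop, div_le_iff₀ hpos] at hq
          rw [← neg_sub x y, map_neg, norm_neg]
          linarith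
      calc Metric.infEDist x' (S x) ≤ edist x' s := Metric.infEDist_le_edist_of_mem hs
        _ = ENNReal.ofReal ‖s - x'‖ := by rw [edist_comm, edist_dist, dist_eq_norm]
        _ ≤ ENNReal.ofReal (L x x' S).toReal := ENNReal.ofReal_le_ofReal hle
        _ = L x x' S := ENNReal.ofReal_toReal htop

/-- Reduction of regularity of `T + N_C` to an existence statement at the origin for the translates
of `T` and `C`. -/
theorem IsMonotone.isRegularMaximalMonotone_add {T : X → Set (StrongDual ℝ X)} (hT : IsMonotone T)
    (C : Set X)
    (h : ∀ M : ℝ, 0 ≤ M → ∀ x x', (∀ y, ∀ y' ∈ translate T x x' y,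
      ∀ n ∈ normalCone ((fun y => y + x) ⁻¹' C) y, 0 ≤ (y' + n) y + M * ‖y‖) →
        ∃ u ∈ translate T x x' 0, ∃ n ∈ normalCone ((fun y => y + x) ⁻¹' C) 0, ‖u + n‖ ≤ M) :
    IsRegularMaximalMonotone (T + subdifferential (indicatorFun C)) := by
  rw [subdifferential_indicatorFun]
  refine (isMonotone_add_normalCone hT C).isRegularMaximalMonotone fun M hM x x' hx => ?_
  obtain ⟨u, hu, n, hn, hle⟩ := h M hM x x' fun y y' hy n hn => by
    have := hx (y + x) _ (Set.add_mem_add hy (mem_normalCone_preimage_add_iff.1 hn))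
    rwa [add_sub_cancel_right, add_right_comm, add_sub_cancel_right] at this
  have hu' : u + x' ∈ T (0 + x) := hu
  rw [mem_normalCone_preimage_add_iff] at hn
  rw [zero_add] at hu' hn
  refine ⟨_, Set.add_mem_add hu' hn, ?_⟩
  rwa [add_right_comm, add_sub_cancel_right]

end Regularity

end MonotoneOperator

open MonotoneOperator in
theorem proposition2p8 {X : Type*} [NormedAddCommGroup X] [NormedSpace ℝ X] [CompleteSpace X]
    [Nontrivial X] (T : X → Set (StrongDual ℝ X)) (hT : IsMaximalMonotone T) :
    (IsClosed (dom T) → Convex ℝ (dom T) →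
      (∀ C ∈ classC1 T, IsRegularMaximalMonotone (T + subdifferential (indicatorFun C))) ∧
        IsC1Regular T) ∧
    (IsFPV T → Convex ℝ (dom T) →
      (∀ C ∈ classC0 T, IsRegularMaximalMonotone (T + subdifferential (indicatorFun C))) ∧
        IsC0Regular T) := by
  refine ⟨fun hDcl hD => ?_, fun hF hD => ?_⟩
  · rw [IsC1Regular, and_self]
    rintro C ⟨hCcl, hC, V, hVc, hV⟩
    rw [hD.convexHull_eq] at hV
    refine hT.1.isRegularMaximalMonotone_add C fun M hM x x' hH => ?_
    have hcont : Continuous fun y : X => y + x := by fun_prop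
    refine (hT.translate x x').exists_norm_add_le_of_isClosed_dom ?_ ?_ (hCcl.preimage hcont)
      (hC.translate_preimage_left x) V hVc ?_ ?_ hM hH
    · exact dom_translate T x x' ▸ hDcl.preimage hcont
    · exact dom_translate T x x' ▸ hD.translate_preimage_left x
    · intro z hz y hy
      rw [dom_translate] at hz
      rw [← SetLike.mem_coe, ← hV]
      refine Set.mem_iUnion₂.2 ⟨1, zero_lt_one' ℝ, ?_⟩
      rw [one_smul]
      exact ⟨z + x, hz, y + x, hy, add_sub_add_right_eq_sub z y x⟩
    · intro v hv
      rw [← SetLike.mem_coe, ← hV] at hv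
      obtain ⟨r, hr, _, ⟨z, hz, y, hy, rfl⟩, rfl⟩ := Set.mem_iUnion₂.1 hv
      refine ⟨r, hr, z - x, ?_, y - x, by simpa using hy, by simp⟩
      rw [dom_translate]
      simpa using hz
  · rw [IsC0Regular, and_self]
    rintro C ⟨hCcl, hC, a, haD, haC⟩
    refine hT.1.isRegularMaximalMonotone_add C fun M hM x x' hH => ?_
    have hcont : Continuous fun y : X => y + x := by fun_prop
    refine (hF.translate x x').exists_norm_add_le ?_ (hCcl.preimage hcont)
      (hC.translate_preimage_left x) ⟨a - x, ?_, ?_⟩ hM hH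
    · exact dom_translate T x x' ▸ hD.translate_preimage_left x
    · rw [dom_translate]
      simpa using haD
    · exact preimage_interior_subset_interior_preimage hcont (by simpa using haC)
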